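/- Let $n,m\ge 1$ and, for $k\in\mathbb{N}_0=\{0,1,2,\dots\}$, let $A_k\in\mathbb{R}^{n\times n}$ be invertible, $B_k\in\mathbb{R}^{n\times m}$, $Q_k\in\mathbb{R}^{n\times n}$ symmetric positive semi-definite with positive semi-definite square root $C_k=Q_k^{1/2}$, and $R_k\in\mathbb{R}^{m\times m}$ symmetric positive definite. For an integer $d\ge 1$ and $t\in\mathbb{N}_0$ put $$\hat A_t = I_{n(d+1)}-\begin{bmatrix}0_{n,nd}&0_{n,n}\\ \bigoplus_{j=0}^{d-1}A_{dt+j}&0_{nd,n}\end{bmatrix},\quad \hat B_t=\begin{bmatrix}0_{n,md}\\ \bigoplus_{j=0}^{d-1}B_{dt+j}\end{bmatrix},\quad \hat C_t=\begin{bmatrix}\bigoplus_{j=0}^{d-1}C_{dt+j}&0_{nd,n}\end{bmatrix},\quad \hat R_t=\bigoplus_{j=0}^{d-1}R_{dt+j},$$ where $\bigoplus$ denotes the block-diagonal matrix. Put $$\Phi_t=\begin{bmatrix}0_{n,nd}&I_n\end{bmatrix}\hat A_t^{-1}\begin{bmatrix}I_n\\0_{nd,n}\end{bmatrix},\qquad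 \Gamma_t=\begin{bmatrix}0_{n,nd}&I_n\end{bmatrix}\hat A_t^{-1}\hat B_t,\qquad \Xi_t=\hat C_t\hat A_t^{-1}\begin{bmatrix}I_n\\0_{nd,n}\end{bmatrix},\qquad \Delta_t=\hat C_t\hat A_t^{-1}\hat B_t$$ ($\hat A_t$ is always invertible; $\Gamma_t$ and $\Xi_t$ are the $d$-step controllability and observability matrices), and, with $'$ denoting the transpose, $$\tilde R_t=\hat R_t+\Delta_t'\Delta_t,\quad \tilde Q_t=\Xi_t'\Xi_t-\Xi_t'\Delta_t\tilde R_t^{-1}\Delta_t'\Xi_t,\quad \tilde A_t=\Phi_t-\Gamma_t\tilde R_t^{-1}\Delta_t'\Xi_t,\quad \tilde B_t=\Gamma_t .$$ For symmetric positive definite $n\times n$ matrices $U,V$ let $\delta(U,V)=\big(\sum_{i=1}^n\log^2\lambda_i\big)^{1/2}$, where $\lambda_1,\dots,\lambda_n$ are the eigenvalues of $UV^{-1}$ with multiplicity. For positive definite $P\in\mathbb{R}^{n\times n}$ define the lifted Riccati operator $$\tilde{\mathcal R}_t(P)=\tilde Q_t+\tilde A_t'\big(P-P\tilde B_t(\tilde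 R_t+\tilde B_t'P\tilde B_t)^{-1}\tilde B_t'P\big)\tilde A_t .$$ Suppose that $d\ge1$ is such that, for every $t\in\mathbb{N}_0$, $\Gamma_t$ has full row rank $n$ and $\Xi_t$ has full column rank $n$. Then, for every $t\in\mathbb{N}_0$, all the inverses above and below exist, $\tilde{\mathcal R}_t$ maps positive definite matrices to positive definite matrices, and, for all symmetric positive definite $X,Y\in\mathbb{R}^{n\times n}$, $$\delta\big(\tilde{\mathcal R}_t(X),\tilde{\mathcal R}_t(Y)\big)\le\tilde\rho_t\,\delta(X,Y),\qquad \tilde\rho_t=\frac{\tilde\zeta_t}{\tilde\zeta_t+\tilde\epsilon_t}<1,$$ where $\tilde\zeta_t+\tilde\epsilon_t>0$ and $$\tilde\zeta_t=\big\|(\tilde Q_t+\tilde Q_t\tilde A_t^{-1}\tilde B_t\tilde R_t^{-1}\tilde B_t'(\tilde A_t')^{-1}\tilde Q_t)^{-1}\big\|_2,$$ $$\tilde\epsilon_t=\lambda_{\min}\big(\tilde A_t^{-1}\tilde B_t(\tilde R_t+\tilde B_t'(\tilde A_t')^{-1}\tilde Q_t\tilde A_t^{-1}\tilde B_t)^{-1}\tilde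 B_t'(\tilde A_t')^{-1}\big),$$ with $\|\cdot\|_2$ the induced 2-norm and $\lambda_{\min}$ the minimum eigenvalue of a symmetric matrix. -/

import Mathlib

open scoped Matrix

/-- The data of a time-varying linear-quadratic problem with dynamics
`x (k+1) = A k x k + B k u k` and stage cost `x' (Q k) x + u' (R k) u`. -/
structure LQData (n m : ℕ) where
  A : ℕ → Matrix (Fin n) (Fin n) ℝ
  B : ℕ → Matrix (Fin n) (Fin m) ℝ
  Q : ℕ → Matrix (Fin n) (Fin n) ℝ
  R : ℕ → Matrix (Fin m) (Fin m) ℝ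

/-- The induced 2-norm of a square real matrix. -/
noncomputable def norm2 {n : ℕ} (M : Matrix (Fin n) (Fin n) ℝ) : ℝ :=
  ‖Matrix.toEuclideanCLM (n := Fin n) (𝕜 := ℝ) M‖

/-- The minimum eigenvalue of a (symmetric) real matrix. -/
noncomputable def lambdaMin {n : ℕ} (M : Matrix (Fin n) (Fin n) ℝ) : ℝ :=
  sInf (spectrum ℝ M)

/-- The Riemannian distance `(∑ i, log² (λ i)) ^ (1/2)`, where the `λ i` are the eigenvalues of
`U * V⁻¹`, counted with algebraic multiplicity (for positive definite `U`, `V` all `n` of them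
are real and positive). -/
noncomputable def riemDist {n : ℕ} (U V : Matrix (Fin n) (Fin n) ℝ) : ℝ :=
  Real.sqrt (((U * V⁻¹).charpoly.roots.map fun l => Real.log l ^ 2).sum)

/-- The Riccati operator of the one-step data `(A, B, Q, R)`. -/
noncomputable def riccati {n : ℕ} {ι : Type*} [Fintype ι] [DecidableEq ι]
    (A : Matrix (Fin n) (Fin n) ℝ) (B : Matrix (Fin n) ι ℝ)
    (Q : Matrix (Fin n) (Fin n) ℝ) (R : Matrix ι ι ℝ)
    (P : Matrix (Fin n) (Fin n) ℝ) : Matrix (Fin n) (Fin n) ℝ :=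
  Q + Aᵀ * (P - P * B * (R + Bᵀ * P * B)⁻¹ * Bᵀ * P) * A

namespace LQData

variable {n m : ℕ} (D : LQData n m) (d t : ℕ)

open scoped MatrixOrder in
/-- `C k` is the positive semidefinite square root of `Q k`. -/
noncomputable def C (k : ℕ) : Matrix (Fin n) (Fin n) ℝ := CFC.sqrt (D.Q k)

/-- The identity minus the block matrix with `A (d t + j)` in block position `(j + 1, j)`,
`0 ≤ j < d`. An index `(i, a)` stands for the coordinate `a` of the block `i`. -/
noncomputable def Ahat : Matrix (Fin (d + 1) × Fin n) (Fin (d + 1) × Fin n) ℝ :=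
  1 - Matrix.of fun p q =>
    if (p.1 : ℕ) = (q.1 : ℕ) + 1 then D.A (d * t + q.1) p.2 q.2 else 0

/-- The block matrix with `B (d t + j)` in block position `(j + 1, j)`, `0 ≤ j < d`. -/
noncomputable def Bhat : Matrix (Fin (d + 1) × Fin n) (Fin d × Fin m) ℝ :=
  Matrix.of fun p q =>
    if (p.1 : ℕ) = (q.1 : ℕ) + 1 then D.B (d * t + q.1) p.2 q.2 else 0

/-- The block matrix with `C (d t + j)` in block position `(j, j)`, `0 ≤ j < d`, and a last
block column that is zero. -/
noncomputable def Chat : Matrix (Fin d × Fin n) (Fin (d + 1) × Fin n) ℝ :=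
  Matrix.of fun p q =>
    if (p.1 : ℕ) = (q.1 : ℕ) then D.C (d * t + p.1) p.2 q.2 else 0

/-- The block-diagonal matrix with the diagonal blocks `R (d t + j)`, `0 ≤ j < d`. -/
noncomputable def Rhat : Matrix (Fin d × Fin m) (Fin d × Fin m) ℝ :=
  Matrix.of fun p q => if p.1 = q.1 then D.R (d * t + p.1) p.2 q.2 else 0

/-- The block column `[I; 0; …; 0]` with `d + 1` blocks. -/
def firstBlock (n d : ℕ) : Matrix (Fin (d + 1) × Fin n) (Fin n) ℝ :=
  Matrix.of fun p b => if p.1 = 0 ∧ p.2 = b then 1 else 0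

/-- The block row `[0 … 0 I]` with `d + 1` blocks. -/
def lastBlock (n d : ℕ) : Matrix (Fin n) (Fin (d + 1) × Fin n) ℝ :=
  Matrix.of fun a q => if q.1 = Fin.last d ∧ a = q.2 then 1 else 0

/-- The `d`-step transition matrix. -/
noncomputable def Phi : Matrix (Fin n) (Fin n) ℝ :=
  lastBlock n d * (D.Ahat d t)⁻¹ * firstBlock n d

/-- The `d`-step controllability matrix. -/
noncomputable def Gamma : Matrix (Fin n) (Fin d × Fin m) ℝ :=
  lastBlock n d * (D.Ahat d t)⁻¹ * D.Bhat d t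

/-- The `d`-step observability matrix. -/
noncomputable def Xi : Matrix (Fin d × Fin n) (Fin n) ℝ :=
  D.Chat d t * (D.Ahat d t)⁻¹ * firstBlock n d

noncomputable def Delta : Matrix (Fin d × Fin n) (Fin d × Fin m) ℝ :=
  D.Chat d t * (D.Ahat d t)⁻¹ * D.Bhat d t

noncomputable def Rtilde : Matrix (Fin d × Fin m) (Fin d × Fin m) ℝ :=
  D.Rhat d t + (D.Delta d t)ᵀ * D.Delta d t

noncomputable def Qtilde : Matrix (Fin n) (Fin n) ℝ :=
  (D.Xi d t)ᵀ * D.Xi d t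
    - (D.Xi d t)ᵀ * D.Delta d t * (D.Rtilde d t)⁻¹ * (D.Delta d t)ᵀ * D.Xi d t

noncomputable def Atilde : Matrix (Fin n) (Fin n) ℝ :=
  D.Phi d t - D.Gamma d t * (D.Rtilde d t)⁻¹ * (D.Delta d t)ᵀ * D.Xi d t

noncomputable def Btilde : Matrix (Fin n) (Fin d × Fin m) ℝ := D.Gamma d t

/-- The lifted Riccati operator. -/
noncomputable def liftedRiccati (P : Matrix (Fin n) (Fin n) ℝ) : Matrix (Fin n) (Fin n) ℝ :=
  riccati (D.Atilde d t) (D.Btilde d t) (D.Qtilde d t) (D.Rtilde d t) P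

/-- The matrix whose inverse has 2-norm `zeta`. -/
noncomputable def zetaMat : Matrix (Fin n) (Fin n) ℝ :=
  D.Qtilde d t + D.Qtilde d t * (D.Atilde d t)⁻¹ * D.Btilde d t * (D.Rtilde d t)⁻¹
    * (D.Btilde d t)ᵀ * ((D.Atilde d t)ᵀ)⁻¹ * D.Qtilde d t

/-- The matrix that is inverted inside the definition of `epsilon`. -/
noncomputable def epsilonInner : Matrix (Fin d × Fin m) (Fin d × Fin m) ℝ :=
  D.Rtilde d t
    + (D.Btilde d t)ᵀ * ((D.Atilde d t)ᵀ)⁻¹ * D.Qtilde d t * (D.Atilde d t)⁻¹ * D.Btilde d t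

/-- The matrix whose minimum eigenvalue is `epsilon`. -/
noncomputable def epsilonMat : Matrix (Fin n) (Fin n) ℝ :=
  (D.Atilde d t)⁻¹ * D.Btilde d t * (D.epsilonInner d t)⁻¹
    * (D.Btilde d t)ᵀ * ((D.Atilde d t)ᵀ)⁻¹

noncomputable def zeta : ℝ := norm2 (D.zetaMat d t)⁻¹

noncomputable def epsilon : ℝ := lambdaMin (D.epsilonMat d t)

noncomputable def rho : ℝ := D.zeta d t / (D.zeta d t + D.epsilon d t)

end LQData

/-! With `Z = Aᵀ P A` and `E = A⁻¹ B R⁻¹ Bᵀ (Aᵀ)⁻¹`, all for the lifted data, the Riccati operator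
is `Q + (Z⁻¹ + E)⁻¹` (`riccati_eq_add_inv`). Two inversions by the Woodbury identity turn its
inverse into `F + M (K⁻¹ + Z)⁻¹ Mᵀ`, where `F = (Q + E⁻¹)⁻¹`, `K = Q⁻¹ + E` and `M = Q⁻¹ K⁻¹`
(`inv_add_inv_add_inv`). Inversion and congruence are isometries of the Riemannian distance, and
translation by a positive semidefinite matrix does not expand it, so the whole rate comes from the
outer translation by `F`.

That translation contracts by `α / (α + β)` as soon as `F ≥ β` and the translated matrices are at
most `α` (`riemDist_add_le`). Here `β = λ_min(F)` is `epsilon`, and `α` is `zeta`, because `M (K⁻¹ +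
Z)⁻¹ Mᵀ ≤ (Q + Q E Q)⁻¹` whatever `Z` is (`congr_inv_le`). The contraction is proved eigenvalue by
eigenvalue: Courant–Fischer compares the `i`-th generalized eigenvalues before and after translation
on one test vector, where weighted AM-GM applies (`add_le_rpow_mul_add`).

It remains to see that the lifted data are regular: observability makes `Qtilde` positive definite,
a Hamiltonian argument makes `Atilde` invertible, and controllability then makes `E` positive
definite. -/

/-! ### Simultaneous diagonalization and invariances of the Riemannian distance -/

/-- `E` diagonalizes the pair of quadratic forms `U`, `V`: it takes `V` to the identity and `U` to
the diagonal matrix of the generalized eigenvalues `l`. -/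
structure IsPencilDiag {n : ℕ} (U V E : Matrix (Fin n) (Fin n) ℝ) (l : Fin n → ℝ) : Prop where
  right : Eᵀ * V * E = 1
  left : Eᵀ * U * E = Matrix.diagonal l

namespace IsPencilDiag

variable {n : ℕ} {U V E : Matrix (Fin n) (Fin n) ℝ} {l : Fin n → ℝ}

theorem isUnit (h : IsPencilDiag U V E l) : IsUnit E :=
  IsUnit.of_mul_eq_one_right _ h.right

theorem isUnit_transpose (h : IsPencilDiag U V E l) : IsUnit Eᵀ :=
  (Matrix.isUnit_transpose _).2 h.isUnit

theorem inv_right (h : IsPencilDiag U V E l) : V⁻¹ = E * Eᵀ := by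
  apply Matrix.inv_eq_left_inv
  have : Eᵀ * V * E = 1 := h.right
  rw [Matrix.mul_assoc]
  exact mul_eq_one_comm.1 this

theorem mul_inv_eq (h : IsPencilDiag U V E l) : U * V⁻¹ = (Eᵀ)⁻¹ * Matrix.diagonal l * Eᵀ := by
  have hT := (Matrix.isUnit_iff_isUnit_det _).1 h.isUnit_transpose
  rw [h.inv_right, ← h.left]
  simp only [Matrix.mul_assoc]
  rw [Matrix.nonsing_inv_mul_cancel_left _ _ hT]

/-- `U * V⁻¹` is similar to the diagonal matrix, so both have the same characteristic polynomial. -/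
theorem riemDist_eq (h : IsPencilDiag U V E l) :
    riemDist U V = Real.sqrt (∑ i, Real.log (l i) ^ 2) := by
  have hc : (U * V⁻¹).charpoly = (Matrix.diagonal l).charpoly := by
    rw [h.mul_inv_eq]
    obtain ⟨u, hu⟩ := h.isUnit_transpose
    rw [← hu]
    exact Matrix.charpoly_units_conj' u _
  unfold riemDist
  have hr : (∏ i, (Polynomial.X - Polynomial.C (l i))).roots = Finset.univ.val.map l := by
    rw [← Polynomial.roots_multiset_prod_X_sub_C (Finset.univ.val.map l), Multiset.map_map]
    rfl
  rw [hc, Matrix.charpoly_diagonal, hr, Multiset.map_map]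
  rfl

theorem dotProduct_right (h : IsPencilDiag U V E l) (c : Fin n → ℝ) :
    (E *ᵥ c) ⬝ᵥ V *ᵥ (E *ᵥ c) = ∑ i, c i ^ 2 := by
  have : (E *ᵥ c) ⬝ᵥ V *ᵥ (E *ᵥ c) = c ⬝ᵥ (Eᵀ * V * E) *ᵥ c := by
    rw [← Matrix.mulVec_mulVec, ← Matrix.mulVec_mulVec, Matrix.dotProduct_mulVec c,
      Matrix.vecMul_transpose]
  rw [this, h.right, Matrix.one_mulVec]
  simp [dotProduct, sq]

theorem dotProduct_left (h : IsPencilDiag U V E l) (c : Fin n → ℝ) :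
    (E *ᵥ c) ⬝ᵥ U *ᵥ (E *ᵥ c) = ∑ i, l i * c i ^ 2 := by
  have : (E *ᵥ c) ⬝ᵥ U *ᵥ (E *ᵥ c) = c ⬝ᵥ (Eᵀ * U * E) *ᵥ c := by
    rw [← Matrix.mulVec_mulVec, ← Matrix.mulVec_mulVec, Matrix.dotProduct_mulVec c,
      Matrix.vecMul_transpose]
  rw [this, h.left]
  simp only [dotProduct, Matrix.mulVec_diagonal]
  exact Finset.sum_congr rfl fun i _ => by ring

theorem pos (h : IsPencilDiag U V E l) (hU : U.PosDef) (i : Fin n) : 0 < l i := by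
  have h1 : (Matrix.diagonal l).PosDef := by
    rw [← h.left]
    exact hU.conjTranspose_mul_mul_same (Matrix.mulVec_injective_iff_isUnit.2 h.isUnit)
  exact (Matrix.posDef_diagonal_iff.1 h1) i

theorem conj (h : IsPencilDiag U V E l) {M : Matrix (Fin n) (Fin n) ℝ} (hM : IsUnit M) :
    IsPencilDiag (M * U * Mᵀ) (M * V * Mᵀ) ((Mᵀ)⁻¹ * E) l := by
  have h1 := (Matrix.isUnit_iff_isUnit_det _).1 hM
  have h2 : IsUnit (Mᵀ).det := by simpa using h1
  have key (W : Matrix (Fin n) (Fin n) ℝ) :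
      ((Mᵀ)⁻¹ * E)ᵀ * (M * W * Mᵀ) * ((Mᵀ)⁻¹ * E) = Eᵀ * W * E := by
    simp only [Matrix.transpose_mul, Matrix.transpose_nonsing_inv, Matrix.transpose_transpose,
      Matrix.mul_assoc]
    rw [Matrix.mul_nonsing_inv_cancel_left _ _ h2, Matrix.nonsing_inv_mul_cancel_left _ _ h1]
  exact ⟨by rw [key, h.right], by rw [key, h.left]⟩

theorem inv (h : IsPencilDiag U V E l) (hl : ∀ i, l i ≠ 0) :
    IsPencilDiag U⁻¹ V⁻¹ (Eᵀ)⁻¹ (fun i => (l i)⁻¹) := by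
  have h1 := (Matrix.isUnit_iff_isUnit_det _).1 h.isUnit
  have key (W : Matrix (Fin n) (Fin n) ℝ) :
      ((Eᵀ)⁻¹)ᵀ * W⁻¹ * (Eᵀ)⁻¹ = (Eᵀ * W * E)⁻¹ := by
    rw [Matrix.mul_inv_rev, Matrix.mul_inv_rev, Matrix.transpose_nonsing_inv,
      Matrix.transpose_transpose, Matrix.mul_assoc]
  refine ⟨by rw [key, h.right, inv_one], ?_⟩
  rw [key, h.left]
  apply Matrix.inv_eq_left_inv
  rw [Matrix.diagonal_mul_diagonal, ← Matrix.diagonal_one]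
  congr 1
  ext i
  exact inv_mul_cancel₀ (hl i)

theorem submatrix (h : IsPencilDiag U V E l) (e : Equiv.Perm (Fin n)) :
    IsPencilDiag U V (E.submatrix id e) (l ∘ e) := by
  have key (W : Matrix (Fin n) (Fin n) ℝ) :
      (E.submatrix id e)ᵀ * W * E.submatrix id e = (Eᵀ * W * E).submatrix e e := by
    ext i j
    simp [Matrix.mul_apply]
  refine ⟨by rw [key, h.right]; simp, ?_⟩
  rw [key, h.left]
  simp [Function.comp_def]

end IsPencilDiag

open scoped MatrixOrder in
theorem Matrix.PosSemidef.exists_eq_transpose_mul_self {n : ℕ} {V : Matrix (Fin n) (Fin n) ℝ}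
    (hV : V.PosSemidef) : ∃ B : Matrix (Fin n) (Fin n) ℝ, V = Bᵀ * B :=
  CStarAlgebra.nonneg_iff_eq_star_mul_self.1 hV.nonneg

/-- A factor `B` of `V⁻¹` whitens `V`; the orthogonal diagonalization of `B U Bᵀ` then leaves the
identity intact. -/
theorem exists_isPencilDiag {n : ℕ} {U V : Matrix (Fin n) (Fin n) ℝ} (hU : U.IsHermitian)
    (hV : V.PosDef) : ∃ E l, IsPencilDiag U V E l := by
  obtain ⟨B, hB⟩ : ∃ B : Matrix (Fin n) (Fin n) ℝ, V⁻¹ = Bᵀ * B := by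
    exact hV.inv.posSemidef.exists_eq_transpose_mul_self
  have hdet := (Matrix.isUnit_iff_isUnit_det _).1 hV.isUnit
  have h1 : B * V * Bᵀ = 1 := by
    rw [mul_eq_one_comm, ← Matrix.mul_assoc, ← hB, Matrix.nonsing_inv_mul _ hdet]
  have hM : (B * U * Bᵀ).IsHermitian := Matrix.isHermitian_mul_mul_conjTranspose B hU
  have hO : ((hM.eigenvectorUnitary : Matrix (Fin n) (Fin n) ℝ))ᵀ
      * (hM.eigenvectorUnitary : Matrix (Fin n) (Fin n) ℝ) = 1 :=
    Unitary.coe_star_mul_self hM.eigenvectorUnitary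
  set O : Matrix (Fin n) (Fin n) ℝ := (hM.eigenvectorUnitary : Matrix (Fin n) (Fin n) ℝ) with hOd
  refine ⟨Bᵀ * O, hM.eigenvalues, ?_, ?_⟩
  · calc (Bᵀ * O)ᵀ * V * (Bᵀ * O) = Oᵀ * (B * V * Bᵀ) * O := by
          simp only [Matrix.transpose_mul, Matrix.transpose_transpose, Matrix.mul_assoc]
      _ = 1 := by rw [h1, Matrix.mul_one, hO]
  · calc (Bᵀ * O)ᵀ * U * (Bᵀ * O) = Oᵀ * (B * U * Bᵀ) * O := by
          simp only [Matrix.transpose_mul, Matrix.transpose_transpose, Matrix.mul_assoc]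
      _ = Matrix.diagonal hM.eigenvalues := by
          have hs : B * U * Bᵀ = O * Matrix.diagonal hM.eigenvalues * Oᵀ := hM.spectral_theorem
          calc Oᵀ * (B * U * Bᵀ) * O
              = Oᵀ * (O * Matrix.diagonal hM.eigenvalues * Oᵀ) * O := congrArg (Oᵀ * · * O) hs
            _ = (Oᵀ * O) * Matrix.diagonal hM.eigenvalues * (Oᵀ * O) := by
                simp only [Matrix.mul_assoc]
            _ = _ := by rw [hO, Matrix.one_mul, Matrix.mul_one]

theorem exists_isPencilDiag_monotone {n : ℕ} {U V : Matrix (Fin n) (Fin n) ℝ}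
    (hU : U.IsHermitian) (hV : V.PosDef) : ∃ E l, IsPencilDiag U V E l ∧ Monotone l := by
  obtain ⟨E, l, h⟩ := exists_isPencilDiag hU hV
  exact ⟨_, _, h.submatrix (Tuple.sort l), Tuple.monotone_sort l⟩

theorem riemDist_conj {n : ℕ} {U V M : Matrix (Fin n) (Fin n) ℝ} (hU : U.PosDef) (hV : V.PosDef)
    (hM : IsUnit M) : riemDist (M * U * Mᵀ) (M * V * Mᵀ) = riemDist U V := by
  obtain ⟨E, l, h⟩ := exists_isPencilDiag hU.isHermitian hV
  rw [(h.conj hM).riemDist_eq, h.riemDist_eq]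

theorem riemDist_inv {n : ℕ} {U V : Matrix (Fin n) (Fin n) ℝ} (hU : U.PosDef) (hV : V.PosDef) :
    riemDist U⁻¹ V⁻¹ = riemDist U V := by
  obtain ⟨E, l, h⟩ := exists_isPencilDiag hU.isHermitian hV
  rw [(h.inv fun i => (h.pos hU i).ne').riemDist_eq, h.riemDist_eq]
  simp [Real.log_inv]

/-- The dimension count of the Courant–Fischer principle for two pairs of quadratic forms. -/
theorem exists_dotProduct_le_of_isPencilDiag {n : ℕ}
    {U V E U' V' E' : Matrix (Fin n) (Fin n) ℝ} {l l' : Fin n → ℝ}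
    (h : IsPencilDiag U V E l) (hl : Monotone l) (h' : IsPencilDiag U' V' E' l')
    (hl' : Monotone l') (i : Fin n) :
    ∃ v : Fin n → ℝ, v ≠ 0 ∧ v ⬝ᵥ U *ᵥ v ≤ l i * (v ⬝ᵥ V *ᵥ v) ∧
      l' i * (v ⬝ᵥ V' *ᵥ v) ≤ v ⬝ᵥ U' *ᵥ v := by
  -- The coordinates of `v` above `i` in the first basis and below `i` in the second must vanish:
  -- only `n - 1` linear conditions, encoded as a square matrix whose row `i` is zero.
  let N : Matrix (Fin n) (Fin n) ℝ := Matrix.of fun j k =>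
    if i < j then E⁻¹ j k else if j < i then E'⁻¹ j k else 0
  have hN : N.det = 0 := Matrix.det_eq_zero_of_row_eq_zero i fun k => by simp [N]
  obtain ⟨v, hv0, hv⟩ := Matrix.exists_mulVec_eq_zero_iff.2 hN
  have hE := (Matrix.isUnit_iff_isUnit_det _).1 h.isUnit
  have hE' := (Matrix.isUnit_iff_isUnit_det _).1 h'.isUnit
  have e1 : E *ᵥ (E⁻¹ *ᵥ v) = v := by
    rw [Matrix.mulVec_mulVec, Matrix.mul_nonsing_inv _ hE, Matrix.one_mulVec]
  have e2 : E' *ᵥ (E'⁻¹ *ᵥ v) = v := by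
    rw [Matrix.mulVec_mulVec, Matrix.mul_nonsing_inv _ hE', Matrix.one_mulVec]
  have z1 : ∀ j, i < j → (E⁻¹ *ᵥ v) j = 0 := fun j hj => by
    have := congrFun hv j
    simpa [N, Matrix.mulVec, dotProduct, hj] using this
  have z2 : ∀ j, j < i → (E'⁻¹ *ᵥ v) j = 0 := fun j hj => by
    have := congrFun hv j
    simpa [N, Matrix.mulVec, dotProduct, hj, hj.le, not_lt.2 hj.le] using this
  refine ⟨v, hv0, ?_, ?_⟩
  · have a1 := h.dotProduct_left (E⁻¹ *ᵥ v)
    have a2 := h.dotProduct_right (E⁻¹ *ᵥ v)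
    rw [e1] at a1 a2
    rw [a1, a2, Finset.mul_sum]
    refine Finset.sum_le_sum fun j _ => ?_
    rcases lt_or_ge i j with hj | hj
    · simp [z1 j hj]
    · exact mul_le_mul_of_nonneg_right (hl hj) (sq_nonneg _)
  · have a1 := h'.dotProduct_left (E'⁻¹ *ᵥ v)
    have a2 := h'.dotProduct_right (E'⁻¹ *ᵥ v)
    rw [e2] at a1 a2
    rw [a1, a2, Finset.mul_sum]
    refine Finset.sum_le_sum fun j _ => ?_
    rcases lt_or_ge j i with hj | hj
    · simp [z2 j hj]
    · exact mul_le_mul_of_nonneg_right (hl' hj) (sq_nonneg _)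

/-! ### Contraction of the distance under translation -/

/-- The worst case is `y = x / κ`, `f = β x / α`; there the claim is the weighted AM-GM inequality
for `κ⁻¹` and `1` with weights `α / (α + β)` and `β / (α + β)`. -/
theorem add_le_rpow_mul_add {α β κ x y f s : ℝ} (hα : 0 < α) (hβ : 0 ≤ β) (hκ : 1 ≤ κ)
    (hx : 0 < x) (hxy : x ≤ κ * y) (hxs : x ≤ α * s) (hf : β * s ≤ f) :
    x + f ≤ κ ^ (α / (α + β)) * (y + f) := by
  have hκ0 : 0 < κ := lt_of_lt_of_le one_pos hκ
  have hab : 0 < α + β := by positivity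
  set k := κ ^ (α / (α + β)) with hk
  have hk0 : 0 < k := Real.rpow_pos_of_pos hκ0 _
  have hk1 : 1 ≤ k := Real.one_le_rpow hκ (by positivity)
  have amgm : k⁻¹ ≤ α / (α + β) * κ⁻¹ + β / (α + β) * 1 := by
    have := Real.geom_mean_le_arith_mean2_weighted (w₁ := α / (α + β)) (w₂ := β / (α + β))
      (p₁ := κ⁻¹) (p₂ := 1) (by positivity) (by positivity) (by positivity) zero_le_one
      (by field_simp)
    rwa [Real.one_rpow, mul_one, Real.inv_rpow hκ0.le] at this
  have key : α + β ≤ k * (α * κ⁻¹ + β) := by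
    have h1 : k⁻¹ * (α + β) ≤ α * κ⁻¹ + β := by
      calc k⁻¹ * (α + β) ≤ (α / (α + β) * κ⁻¹ + β / (α + β) * 1) * (α + β) := by gcongr
        _ = α * κ⁻¹ + β := by field_simp
    calc α + β = k * (k⁻¹ * (α + β)) := by field_simp
      _ ≤ _ := by gcongr
  have hy : x * κ⁻¹ ≤ y := by
    rw [← div_eq_mul_inv, div_le_iff₀ hκ0]; linarith
  have hs : x / α ≤ s := by rw [div_le_iff₀ hα]; linarith
  have hf' : β * (x / α) ≤ f := (mul_le_mul_of_nonneg_left hs hβ).trans hf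
  have h2 : x + β * (x / α) ≤ k * (x * κ⁻¹ + β * (x / α)) := by
    have := mul_le_mul_of_nonneg_left key (show 0 ≤ x / α by positivity)
    calc x + β * (x / α) = x / α * (α + β) := by field_simp
      _ ≤ x / α * (k * (α * κ⁻¹ + β)) := this
      _ = _ := by field_simp
  -- Since `k ≥ 1`, any excess of `f` over `β x / α` only helps.
  have h3 : (k - 1) * (β * (x / α)) ≤ (k - 1) * f :=
    mul_le_mul_of_nonneg_left hf' (by linarith)
  have h4 : k * (x * κ⁻¹) ≤ k * y := mul_le_mul_of_nonneg_left hy hk0.le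
  linarith

/-- The scalar inequality needs a ratio of at least `1`, hence the maximum; for `l < 1` it yields
`log μ ≤ 0`, which suffices. -/
theorem log_le_mul_abs_log {μ l r : ℝ} (hμ : 0 < μ) (hl : 0 < l) (hr : 0 ≤ r)
    (h : μ ≤ (max l 1) ^ r) : Real.log μ ≤ r * |Real.log l| := by
  have h1 := Real.log_le_log hμ h
  rw [Real.log_rpow (by positivity)] at h1
  refine h1.trans (mul_le_mul_of_nonneg_left ?_ hr)
  rcases max_cases l 1 with ⟨e, _⟩ | ⟨e, _⟩ <;> rw [e]
  · exact le_abs_self _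
  · simp

theorem riemDist_add_le {n : ℕ} {X Y F : Matrix (Fin n) (Fin n) ℝ} (hX : X.PosDef)
    (hY : Y.PosDef) (hF : F.PosSemidef) {α β : ℝ} (hα : 0 < α) (hβ : 0 ≤ β)
    (hXα : ∀ v : Fin n → ℝ, v ⬝ᵥ X *ᵥ v ≤ α * (v ⬝ᵥ v))
    (hYα : ∀ v : Fin n → ℝ, v ⬝ᵥ Y *ᵥ v ≤ α * (v ⬝ᵥ v))
    (hFβ : ∀ v : Fin n → ℝ, β * (v ⬝ᵥ v) ≤ v ⬝ᵥ F *ᵥ v) :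
    riemDist (F + X) (F + Y) ≤ α / (α + β) * riemDist X Y := by
  have hr : 0 ≤ α / (α + β) := by positivity
  have hFX := hF.isHermitian.add hX.isHermitian
  have hFXp : (F + X).PosDef := Matrix.PosDef.posSemidef_add hF hX
  have hFYp : (F + Y).PosDef := Matrix.PosDef.posSemidef_add hF hY
  obtain ⟨E, l, h, hl⟩ := exists_isPencilDiag_monotone hX.isHermitian hY
  obtain ⟨E', m, h', hm⟩ := exists_isPencilDiag_monotone hFX hFYp
  have hlpos := h.pos hX
  have hmpos := h'.pos hFXp
  have qX {v : Fin n → ℝ} (hv : v ≠ 0) : 0 < v ⬝ᵥ X *ᵥ v := hX.dotProduct_mulVec_pos hv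
  have qY {v : Fin n → ℝ} (hv : v ≠ 0) : 0 < v ⬝ᵥ Y *ᵥ v := hY.dotProduct_mulVec_pos hv
  have qFX {v : Fin n → ℝ} (hv : v ≠ 0) : 0 < v ⬝ᵥ F *ᵥ v + v ⬝ᵥ X *ᵥ v := by
    simpa [Matrix.add_mulVec] using hFXp.dotProduct_mulVec_pos hv
  have qFY {v : Fin n → ℝ} (hv : v ≠ 0) : 0 < v ⬝ᵥ F *ᵥ v + v ⬝ᵥ Y *ᵥ v := by
    simpa [Matrix.add_mulVec] using hFYp.dotProduct_mulVec_pos hv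
  have key (i : Fin n) : |Real.log (m i)| ≤ α / (α + β) * |Real.log (l i)| := by
    rw [abs_le']
    constructor
    · obtain ⟨v, hv0, h1, h2⟩ := exists_dotProduct_le_of_isPencilDiag h hl h' hm i
      simp only [Matrix.add_mulVec, dotProduct_add] at h2
      refine log_le_mul_abs_log (hmpos i) (hlpos i) hr ?_
      have h3 := add_le_rpow_mul_add hα hβ (le_max_right (l i) 1) (qX hv0)
        (h1.trans (mul_le_mul_of_nonneg_right (le_max_left _ _) (qY hv0).le)) (hXα v) (hFβ v)
      refine le_of_mul_le_mul_right ?_ (qFY hv0)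
      linarith
    -- The lower bound is the upper bound with `X` and `Y` exchanged, which inverts the generalized
    -- eigenvalues.
    · obtain ⟨v, hv0, h1, h2⟩ := exists_dotProduct_le_of_isPencilDiag h' hm h hl i
      simp only [Matrix.add_mulVec, dotProduct_add] at h1
      rw [← Real.log_inv, ← abs_neg (Real.log (l i)), ← Real.log_inv]
      refine log_le_mul_abs_log (inv_pos.2 (hmpos i)) (inv_pos.2 (hlpos i)) hr ?_
      have h4 : v ⬝ᵥ Y *ᵥ v ≤ (l i)⁻¹ * (v ⬝ᵥ X *ᵥ v) := by
        rw [inv_mul_eq_div, le_div_iff₀ (hlpos i)]; linarith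
      have h3 := add_le_rpow_mul_add hα hβ (le_max_right (l i)⁻¹ 1) (qY hv0)
        (h4.trans (mul_le_mul_of_nonneg_right (le_max_left _ _) (qX hv0).le)) (hYα v) (hFβ v)
      refine le_of_mul_le_mul_right ?_ (qFX hv0)
      have h5 : (m i)⁻¹ * (v ⬝ᵥ F *ᵥ v + v ⬝ᵥ X *ᵥ v) ≤ v ⬝ᵥ F *ᵥ v + v ⬝ᵥ Y *ᵥ v := by
        rw [inv_mul_eq_div, div_le_iff₀ (hmpos i)]; linarith
      linarith
  rw [h.riemDist_eq, h'.riemDist_eq]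
  rw [← Real.sqrt_sq hr, ← Real.sqrt_mul (sq_nonneg _), Finset.mul_sum]
  refine Real.sqrt_le_sqrt (Finset.sum_le_sum fun i _ => ?_)
  rw [← mul_pow, ← sq_abs, ← sq_abs (_ * _), abs_mul, abs_of_nonneg hr]
  exact pow_le_pow_left₀ (abs_nonneg _) (key i) 2

/-! ### Quadratic form bounds from the norm and the least eigenvalue -/

theorem dotProduct_mulVec_le_norm2 {n : ℕ} (M : Matrix (Fin n) (Fin n) ℝ) (v : Fin n → ℝ) :
    v ⬝ᵥ M *ᵥ v ≤ norm2 M * (v ⬝ᵥ v) := by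
  set x : EuclideanSpace ℝ (Fin n) := WithLp.toLp 2 v with hx
  have h1 : v ⬝ᵥ M *ᵥ v = inner ℝ x (Matrix.toEuclideanCLM (n := Fin n) (𝕜 := ℝ) M x) := by
    rw [hx, Matrix.toEuclideanCLM_toLp, EuclideanSpace.inner_toLp_toLp, dotProduct_comm]
    simp
  have h2 : v ⬝ᵥ v = ‖x‖ * ‖x‖ := by
    rw [← real_inner_self_eq_norm_mul_norm, hx, EuclideanSpace.inner_toLp_toLp]
    simp
  rw [h1, h2]
  calc _ ≤ ‖x‖ * ‖Matrix.toEuclideanCLM (n := Fin n) (𝕜 := ℝ) M x‖ := real_inner_le_norm _ _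
    _ ≤ ‖x‖ * (norm2 M * ‖x‖) := by
        gcongr
        exact ContinuousLinearMap.le_opNorm _ _
    _ = _ := by ring

theorem norm2_nonneg {n : ℕ} (M : Matrix (Fin n) (Fin n) ℝ) : 0 ≤ norm2 M := norm_nonneg _

theorem norm2_pos {n : ℕ} (hn : 0 < n) {M : Matrix (Fin n) (Fin n) ℝ} (hM : M.PosDef) :
    0 < norm2 M := by
  have h := dotProduct_mulVec_le_norm2 M (fun _ => 1)
  have hne : (fun _ => 1 : Fin n → ℝ) ≠ 0 := fun h0 => by
    simpa using congrFun h0 ⟨0, hn⟩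
  have h1 : 0 < (fun _ => 1 : Fin n → ℝ) ⬝ᵥ M *ᵥ (fun _ => 1) := hM.dotProduct_mulVec_pos hne
  rcases (norm2_nonneg M).lt_or_eq with h2 | h2
  · exact h2
  · rw [← h2, zero_mul] at h
    exact absurd h1 (not_lt.2 h)

theorem IsPencilDiag.lambdaMin_eq {n : ℕ} {F E : Matrix (Fin n) (Fin n) ℝ} {l : Fin n → ℝ}
    (h : IsPencilDiag F 1 E l) : lambdaMin F = ⨅ i, l i := by
  have h1 : F = (Eᵀ)⁻¹ * Matrix.diagonal l * Eᵀ := by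
    rw [← h.mul_inv_eq, inv_one, mul_one]
  obtain ⟨u, hu⟩ := h.isUnit_transpose
  have h2 : spectrum ℝ F = Set.range l := by
    rw [h1, ← hu, ← spectrum_diagonal]
    simpa using spectrum.units_conjugate' (R := ℝ) (a := Matrix.diagonal l) (u := u)
  rw [lambdaMin, h2, iInf]

theorem lambdaMin_pos {n : ℕ} (hn : 0 < n) {F : Matrix (Fin n) (Fin n) ℝ} (hF : F.PosDef) :
    0 < lambdaMin F := by
  obtain ⟨E, l, h⟩ := exists_isPencilDiag hF.isHermitian Matrix.PosDef.one
  have : Nonempty (Fin n) := ⟨⟨0, hn⟩⟩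
  rw [h.lambdaMin_eq]
  obtain ⟨i, hi⟩ := exists_eq_ciInf_of_finite (f := l)
  rw [← hi]
  exact h.pos hF i

theorem lambdaMin_mul_le {n : ℕ} {F : Matrix (Fin n) (Fin n) ℝ} (hF : F.IsHermitian)
    (v : Fin n → ℝ) : lambdaMin F * (v ⬝ᵥ v) ≤ v ⬝ᵥ F *ᵥ v := by
  obtain ⟨E, l, h⟩ := exists_isPencilDiag hF Matrix.PosDef.one
  have hE := (Matrix.isUnit_iff_isUnit_det _).1 h.isUnit
  have e1 : E *ᵥ (E⁻¹ *ᵥ v) = v := by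
    rw [Matrix.mulVec_mulVec, Matrix.mul_nonsing_inv _ hE, Matrix.one_mulVec]
  have a1 := h.dotProduct_left (E⁻¹ *ᵥ v)
  have a2 := h.dotProduct_right (E⁻¹ *ᵥ v)
  rw [e1, Matrix.one_mulVec] at a2
  rw [e1] at a1
  rw [a1, a2, h.lambdaMin_eq, Finset.mul_sum]
  exact Finset.sum_le_sum fun j _ =>
    mul_le_mul_of_nonneg_right (ciInf_le (Set.finite_range l).bddBelow j) (sq_nonneg _)

theorem riemDist_nonexpansive_add {n : ℕ} {X Y F : Matrix (Fin n) (Fin n) ℝ} (hX : X.PosDef)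
    (hY : Y.PosDef) (hF : F.PosSemidef) : riemDist (F + X) (F + Y) ≤ riemDist X Y := by
  -- Any common upper bound `α` serves, as `β = 0` gives the rate `1`; the summand `1` keeps `α`
  -- positive in dimension zero.
  have hα : 0 < norm2 X + norm2 Y + 1 := by
    have := norm2_nonneg X
    have := norm2_nonneg Y
    linarith
  have hvv (v : Fin n → ℝ) : 0 ≤ v ⬝ᵥ v := by
    simpa using dotProduct_star_self_nonneg v
  have h := riemDist_add_le hX hY hF hα le_rfl
    (fun v => (dotProduct_mulVec_le_norm2 X v).trans (mul_le_mul_of_nonneg_right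
      (by linarith [norm2_nonneg Y]) (hvv v)))
    (fun v => (dotProduct_mulVec_le_norm2 Y v).trans (mul_le_mul_of_nonneg_right
      (by linarith [norm2_nonneg X]) (hvv v)))
    (fun v => by rw [zero_mul]; exact hF.dotProduct_mulVec_nonneg v)
  rwa [add_zero, div_self hα.ne', one_mul] at h

/-! ### Rank, positive definiteness and Woodbury identities -/

namespace Matrix

theorem mulVec_injective_of_rank_eq {κ ι : Type*} [Fintype ι] {M : Matrix κ ι ℝ} (h : M.rank = Fintype.card ι) :
    Function.Injective M.mulVec := by
  rw [Matrix.mulVec_injective_iff, linearIndependent_iff_card_eq_finrank_span, ← h,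
    Matrix.rank_eq_finrank_span_cols]
  rfl

variable {κ ι : Type*} [Fintype κ] [Fintype ι]

theorem PosDef.add_transpose_mul_mul {R : Matrix ι ι ℝ} {P : Matrix κ κ ℝ}
    (hR : R.PosDef) (hP : P.PosSemidef) (B : Matrix κ ι ℝ) : (R + Bᵀ * P * B).PosDef :=
  hR.add_posSemidef (hP.conjTranspose_mul_mul_same B)

theorem PosDef.mul_mul_transpose {R : Matrix ι ι ℝ} (hR : R.PosDef) {B : Matrix κ ι ℝ}
    (hB : Function.Injective B.vecMul) : (B * R * Bᵀ).PosDef :=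
  hR.mul_mul_conjTranspose_same hB

variable [DecidableEq κ] [DecidableEq ι]

theorem PosDef.inv_add_eq_sub {P S : Matrix κ κ ℝ} (hP : P.PosDef) (hS : S.PosDef) :
    (P + S)⁻¹ = P⁻¹ - P⁻¹ * (P⁻¹ + S⁻¹)⁻¹ * P⁻¹ := by
  have h := add_mul_mul_inv_eq_sub P 1 S 1 hP.isUnit hS.isUnit
    (by simpa using (hS.inv.add hP.inv).isUnit)
  simpa [add_comm] using h

theorem PosDef.inv_inv_eq {P : Matrix κ κ ℝ} (hP : P.PosDef) : P⁻¹⁻¹ = P :=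
  nonsing_inv_nonsing_inv _ ((isUnit_iff_isUnit_det _).1 hP.isUnit)

theorem PosDef.inv_inv_add_mul_mul {R : Matrix ι ι ℝ} {P : Matrix κ κ ℝ}
    (hR : R.PosDef) (hP : P.PosDef) (B : Matrix κ ι ℝ) :
    (P⁻¹ + B * R⁻¹ * Bᵀ)⁻¹ = P - P * B * (R + Bᵀ * P * B)⁻¹ * Bᵀ * P := by
  have h := add_mul_mul_inv_eq_sub P⁻¹ B R⁻¹ Bᵀ hP.inv.isUnit hR.inv.isUnit
    (by rw [hP.inv_inv_eq, hR.inv_inv_eq]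
        exact (hR.add_transpose_mul_mul hP.posSemidef B).isUnit)
  rwa [hP.inv_inv_eq, hR.inv_inv_eq] at h

theorem PosDef.conj_isUnit {P M : Matrix κ κ ℝ} (hP : P.PosDef) (hM : IsUnit M) :
    (M * P * Mᵀ).PosDef :=
  hP.mul_mul_transpose (vecMul_injective_iff_isUnit.2 hM)

/-- Identifies the matrix defining `epsilon` with the translation `(Q + E⁻¹)⁻¹`, by applying
Woodbury twice. -/
theorem PosDef.inv_add_inv_eq {R : Matrix ι ι ℝ} {Q : Matrix κ κ ℝ} (hR : R.PosDef)
    (hQ : Q.PosDef) (G : Matrix κ ι ℝ) (hE : (G * R⁻¹ * Gᵀ).PosDef) :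
    (Q + (G * R⁻¹ * Gᵀ)⁻¹)⁻¹ = G * (R + Gᵀ * Q * G)⁻¹ * Gᵀ := by
  have hdet := (isUnit_iff_isUnit_det _).1 hQ.isUnit
  rw [hQ.inv_add_eq_sub hE.inv, hE.inv_inv_eq, hR.inv_inv_add_mul_mul hQ G]
  have (W : Matrix κ κ ℝ) : Q⁻¹ - Q⁻¹ * (Q - Q * W * Q) * Q⁻¹ = W := by
    simp only [Matrix.mul_sub, Matrix.sub_mul, Matrix.mul_assoc,
      Matrix.nonsing_inv_mul_cancel_left _ _ hdet, Matrix.mul_nonsing_inv _ hdet, Matrix.mul_one]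
    abel
  simpa only [Matrix.mul_assoc] using this (G * (R + Gᵀ * Q * G)⁻¹ * Gᵀ)

end Matrix

/-! ### The Riccati operator in inverse coordinates -/

section Riccati

variable {n : ℕ} {ι : Type*} [Fintype ι] [DecidableEq ι]
  {A Q P : Matrix (Fin n) (Fin n) ℝ} {B : Matrix (Fin n) ι ℝ} {R : Matrix ι ι ℝ}

theorem riccati_eq_add_inv (hA : IsUnit A) (hR : R.PosDef) (hP : P.PosDef) :
    riccati A B Q R P =
      Q + ((Aᵀ * P * A)⁻¹ + (A⁻¹ * B) * R⁻¹ * (A⁻¹ * B)ᵀ)⁻¹ := by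
  have hdet := (Matrix.isUnit_iff_isUnit_det _).1 hA
  have hdetT : IsUnit (Aᵀ).det := by simpa using hdet
  have h : (Aᵀ * P * A)⁻¹ + (A⁻¹ * B) * R⁻¹ * (A⁻¹ * B)ᵀ
      = A⁻¹ * (P⁻¹ + B * R⁻¹ * Bᵀ) * (Aᵀ)⁻¹ := by
    simp only [Matrix.mul_inv_rev, Matrix.transpose_mul, Matrix.transpose_nonsing_inv,
      Matrix.mul_add, Matrix.add_mul, Matrix.mul_assoc]
  rw [h, Matrix.mul_inv_rev, Matrix.mul_inv_rev, Matrix.nonsing_inv_nonsing_inv _ hdet,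
    Matrix.nonsing_inv_nonsing_inv _ hdetT, hR.inv_inv_add_mul_mul hP, riccati, Matrix.mul_assoc]

theorem Matrix.PosDef.riccati_posDef (hA : IsUnit A) (hR : R.PosDef) (hQ : Q.PosDef)
    (hP : P.PosDef) : (riccati A B Q R P).PosDef := by
  rw [riccati_eq_add_inv hA hR hP]
  have h1 : (Aᵀ * P * A).PosDef := by
    simpa using hP.conj_isUnit ((Matrix.isUnit_transpose A).2 hA)
  have h2 : ((A⁻¹ * B) * R⁻¹ * (A⁻¹ * B)ᵀ).PosSemidef :=
    hR.inv.posSemidef.mul_mul_conjTranspose_same _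
  exact hQ.add (h1.inv.add_posSemidef h2).inv

/-- In the coordinates `P⁻¹`, the Riccati operator is a congruence and two translations. -/
theorem inv_add_inv_add_inv {Z E : Matrix (Fin n) (Fin n) ℝ} (hQ : Q.PosDef) (hZ : Z.PosDef)
    (hE : E.PosDef) :
    (Q + (Z⁻¹ + E)⁻¹)⁻¹ =
      (Q + E⁻¹)⁻¹ + (Q⁻¹ * (Q⁻¹ + E)⁻¹) * ((Q⁻¹ + E)⁻¹ + Z)⁻¹ * (Q⁻¹ * (Q⁻¹ + E)⁻¹)ᵀ := by
  have hK := hQ.inv.add hE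
  have hVi : (Z⁻¹ + E).PosDef := hZ.inv.add hE
  have hKsymm : ((Q⁻¹ + E)⁻¹)ᵀ = (Q⁻¹ + E)⁻¹ := hK.inv.isHermitian
  have hQsymm : (Q⁻¹)ᵀ = Q⁻¹ := hQ.inv.isHermitian
  -- The two minus signs, from this expansion of `(K + Z⁻¹)⁻¹` and from the outer one, combine to
  -- the plus sign of the claim.
  have h3 := hK.inv_add_eq_sub hZ.inv
  rw [hZ.inv_inv_eq] at h3
  rw [hQ.inv_add_eq_sub hVi.inv, hQ.inv_add_eq_sub hE.inv, hVi.inv_inv_eq, hE.inv_inv_eq,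
    add_comm Z⁻¹ E, ← add_assoc, h3, Matrix.transpose_mul, hKsymm, hQsymm]
  noncomm_ring

/-- Since `Q + Q E Q = Q K Q` with `K = Q⁻¹ + E`, the gap between the two sides is the form of `Q⁻¹
(K + Z⁻¹)⁻¹ Q⁻¹`, which is nonnegative. -/
theorem congr_inv_le {Z E : Matrix (Fin n) (Fin n) ℝ} (hQ : Q.PosDef) (hZ : Z.PosDef)
    (hE : E.PosDef) (v : Fin n → ℝ) :
    v ⬝ᵥ ((Q⁻¹ * (Q⁻¹ + E)⁻¹) * ((Q⁻¹ + E)⁻¹ + Z)⁻¹ * (Q⁻¹ * (Q⁻¹ + E)⁻¹)ᵀ) *ᵥ v ≤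
      v ⬝ᵥ (Q + Q * E * Q)⁻¹ *ᵥ v := by
  have hK := hQ.inv.add hE
  have hdet := (Matrix.isUnit_iff_isUnit_det _).1 hQ.isUnit
  have hKsymm : ((Q⁻¹ + E)⁻¹)ᵀ = (Q⁻¹ + E)⁻¹ := hK.inv.isHermitian
  have hQsymm : (Q⁻¹)ᵀ = Q⁻¹ := hQ.inv.isHermitian
  have h3 := hK.inv_add_eq_sub hZ.inv
  rw [hZ.inv_inv_eq] at h3
  have h4 : (Q + Q * E * Q)⁻¹ = Q⁻¹ * (Q⁻¹ + E)⁻¹ * Q⁻¹ := by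
    have : Q + Q * E * Q = Q * (Q⁻¹ + E) * Q := by
      rw [Matrix.mul_add, Matrix.mul_nonsing_inv _ hdet, Matrix.add_mul, Matrix.one_mul]
    rw [this, Matrix.mul_inv_rev, Matrix.mul_inv_rev, Matrix.mul_assoc]
  have h5 : (Q + Q * E * Q)⁻¹ =
      (Q⁻¹ * (Q⁻¹ + E)⁻¹) * ((Q⁻¹ + E)⁻¹ + Z)⁻¹ * (Q⁻¹ * (Q⁻¹ + E)⁻¹)ᵀ
        + Q⁻¹ * (Q⁻¹ + E + Z⁻¹)⁻¹ * (Q⁻¹)ᵀ := by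
    rw [h4, h3, Matrix.transpose_mul, hKsymm, hQsymm]
    noncomm_ring
  have h6 : (Q⁻¹ * (Q⁻¹ + E + Z⁻¹)⁻¹ * (Q⁻¹)ᵀ).PosSemidef :=
    (hK.add hZ.inv).inv.posSemidef.mul_mul_conjTranspose_same _
  have h7 : 0 ≤ v ⬝ᵥ (Q⁻¹ * (Q⁻¹ + E + Z⁻¹)⁻¹ * (Q⁻¹)ᵀ) *ᵥ v := h6.dotProduct_mulVec_nonneg v
  rw [h5, Matrix.add_mulVec, dotProduct_add]
  linarith

theorem riemDist_riccati_le (hn : 0 < n) (hA : IsUnit A) (hR : R.PosDef) (hQ : Q.PosDef)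
    {E : Matrix (Fin n) (Fin n) ℝ} (hEp : E.PosDef)
    (hE : E = (A⁻¹ * B) * R⁻¹ * (A⁻¹ * B)ᵀ) {X Y : Matrix (Fin n) (Fin n) ℝ} (hX : X.PosDef)
    (hY : Y.PosDef) :
    riemDist (riccati A B Q R X) (riccati A B Q R Y) ≤
      norm2 (Q + Q * E * Q)⁻¹ / (norm2 (Q + Q * E * Q)⁻¹ + lambdaMin (Q + E⁻¹)⁻¹)
        * riemDist X Y := by
  have hAT : IsUnit Aᵀ := (Matrix.isUnit_transpose A).2 hA
  have hZ {P : Matrix (Fin n) (Fin n) ℝ} (hP : P.PosDef) : (Aᵀ * P * A).PosDef := by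
    simpa using hP.conj_isUnit hAT
  have hK := hQ.inv.add hEp
  have hF : ((Q + E⁻¹)⁻¹).PosDef := (hQ.add hEp.inv).inv
  have hN : ((Q + Q * E * Q)⁻¹).PosDef := by
    have : (Q * E * Qᵀ).PosSemidef := hEp.posSemidef.mul_mul_conjTranspose_same _
    have hs : Qᵀ = Q := hQ.isHermitian
    rw [hs] at this
    exact (hQ.add_posSemidef this).inv
  have hM : IsUnit (Q⁻¹ * (Q⁻¹ + E)⁻¹) := hQ.inv.isUnit.mul hK.inv.isUnit
  have hsum {P : Matrix (Fin n) (Fin n) ℝ} (hP : P.PosDef) :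
      ((Q⁻¹ + E)⁻¹ + Aᵀ * P * A).PosDef := hK.inv.add (hZ hP)
  have hpos {P : Matrix (Fin n) (Fin n) ℝ} (hP : P.PosDef) := (hsum hP).inv.conj_isUnit hM
  have hbd {P : Matrix (Fin n) (Fin n) ℝ} (hP : P.PosDef) (v : Fin n → ℝ) :=
    (congr_inv_le hQ (hZ hP) hEp v).trans (dotProduct_mulVec_le_norm2 _ v)
  have hric {P : Matrix (Fin n) (Fin n) ℝ} (hP : P.PosDef) := by
    have h := inv_add_inv_add_inv hQ (hZ hP) hEp
    rwa [hE, ← riccati_eq_add_inv hA hR hP, ← hE] at h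
  have hn0 := norm2_pos hn hN
  have hl0 := (lambdaMin_pos hn hF).le
  calc riemDist (riccati A B Q R X) (riccati A B Q R Y)
      = riemDist (riccati A B Q R X)⁻¹ (riccati A B Q R Y)⁻¹ :=
        (riemDist_inv (Matrix.PosDef.riccati_posDef hA hR hQ hX)
          (Matrix.PosDef.riccati_posDef hA hR hQ hY)).symm
    _ ≤ _ * riemDist _ _ := by
        rw [hric hX, hric hY]
        exact riemDist_add_le (hpos hX) (hpos hY) hF.posSemidef hn0 hl0 (hbd hX) (hbd hY)
          (lambdaMin_mul_le hF.isHermitian)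
    _ ≤ _ * riemDist X Y := by
        -- The remaining maps are isometries, except for the inner translation by `(Q⁻¹ + E)⁻¹`,
        -- which is nonexpansive.
        refine mul_le_mul_of_nonneg_left ?_ (by positivity)
        rw [riemDist_conj (hsum hX).inv (hsum hY).inv hM, riemDist_inv (hsum hX) (hsum hY)]
        refine (riemDist_nonexpansive_add (hZ hX) (hZ hY) hK.inv.posSemidef).trans_eq ?_
        simpa using riemDist_conj hX hY hAT

end Riccati

/-! ### Block structure and regularity of the lifted system -/

namespace LQData

variable {n m : ℕ} (D : LQData n m) (d t : ℕ)

/-- These index equivalences have the shape in which `Finset.sum_ite_eq` collapses a sum over blocks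
to a single block. -/
theorem coe_succ_eq_iff {d : ℕ} (k : Fin d) (j : Fin (d + 1)) :
    (k.succ : ℕ) = (j : ℕ) + 1 ↔ k.castSucc = j := by
  simp [Fin.ext_iff]

theorem coe_eq_coe_add_one_iff {d : ℕ} (k : Fin d) (i : Fin (d + 1)) :
    (i : ℕ) = (k : ℕ) + 1 ↔ k.succ = i := by
  simp [Fin.ext_iff, eq_comm]

theorem coe_eq_coe_iff {d : ℕ} (k : Fin d) (j : Fin (d + 1)) :
    (k : ℕ) = (j : ℕ) ↔ k.castSucc = j := by
  simp [Fin.ext_iff]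

theorem Ahat_mulVec_zero (v : Fin (d + 1) × Fin n → ℝ) (a : Fin n) :
    (D.Ahat d t *ᵥ v) (0, a) = v (0, a) := by
  rw [Ahat, Matrix.sub_mulVec, Matrix.one_mulVec]
  simp [Matrix.mulVec, dotProduct]

theorem Ahat_mulVec_succ (v : Fin (d + 1) × Fin n → ℝ) (k : Fin d) (a : Fin n) :
    (D.Ahat d t *ᵥ v) (k.succ, a) =
      v (k.succ, a) - (D.A (d * t + k) *ᵥ fun b => v (k.castSucc, b)) a := by
  rw [Ahat, Matrix.sub_mulVec, Matrix.one_mulVec]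
  simp only [Pi.sub_apply, Matrix.mulVec, dotProduct, Matrix.of_apply, coe_succ_eq_iff,
    Fintype.sum_prod_type_right, ite_mul, zero_mul, Finset.sum_ite_eq, Finset.mem_univ, if_true,
    Fin.val_castSucc]

theorem Ahat_transpose_mulVec_last (w : Fin (d + 1) × Fin n → ℝ) (a : Fin n) :
    ((D.Ahat d t)ᵀ *ᵥ w) (Fin.last d, a) = w (Fin.last d, a) := by
  rw [Ahat, Matrix.transpose_sub, Matrix.transpose_one, Matrix.sub_mulVec, Matrix.one_mulVec]
  have (i : Fin (d + 1)) : (i : ℕ) ≠ d + 1 := i.is_lt.ne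
  simp [Matrix.mulVec, dotProduct, this]

theorem Ahat_transpose_mulVec_castSucc (w : Fin (d + 1) × Fin n → ℝ) (k : Fin d) (a : Fin n) :
    ((D.Ahat d t)ᵀ *ᵥ w) (k.castSucc, a) =
      w (k.castSucc, a) - ((D.A (d * t + k))ᵀ *ᵥ fun b => w (k.succ, b)) a := by
  rw [Ahat, Matrix.transpose_sub, Matrix.transpose_one, Matrix.sub_mulVec, Matrix.one_mulVec]
  simp only [Pi.sub_apply, Matrix.mulVec, dotProduct, Matrix.of_apply, Matrix.transpose_apply,
    Fin.val_castSucc, coe_eq_coe_add_one_iff,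
    Fintype.sum_prod_type_right, ite_mul, zero_mul, Finset.sum_ite_eq, Finset.mem_univ, if_true]

theorem Bhat_mulVec_zero (u : Fin d × Fin m → ℝ) (a : Fin n) :
    (D.Bhat d t *ᵥ u) (0, a) = 0 := by
  simp [Bhat, Matrix.mulVec, dotProduct]

theorem Bhat_mulVec_succ (u : Fin d × Fin m → ℝ) (k : Fin d) (a : Fin n) :
    (D.Bhat d t *ᵥ u) (k.succ, a) = (D.B (d * t + k) *ᵥ fun b => u (k, b)) a := by
  simp only [Bhat, Matrix.mulVec, dotProduct, Matrix.of_apply, Fin.val_succ, add_left_inj,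
    Fin.val_inj, Fintype.sum_prod_type_right, ite_mul, zero_mul, Finset.sum_ite_eq,
    Finset.mem_univ, if_true]

theorem Bhat_transpose_mulVec (w : Fin (d + 1) × Fin n → ℝ) (k : Fin d) (a : Fin m) :
    ((D.Bhat d t)ᵀ *ᵥ w) (k, a) = ((D.B (d * t + k))ᵀ *ᵥ fun b => w (k.succ, b)) a := by
  simp only [Bhat, Matrix.mulVec, dotProduct, Matrix.of_apply, Matrix.transpose_apply,
    coe_eq_coe_add_one_iff,
    Fintype.sum_prod_type_right, ite_mul, zero_mul, Finset.sum_ite_eq, Finset.mem_univ, if_true]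

theorem Chat_mulVec (v : Fin (d + 1) × Fin n → ℝ) (k : Fin d) (a : Fin n) :
    (D.Chat d t *ᵥ v) (k, a) = (D.C (d * t + k) *ᵥ fun b => v (k.castSucc, b)) a := by
  simp only [Chat, Matrix.mulVec, dotProduct, Matrix.of_apply, coe_eq_coe_iff,
    Fintype.sum_prod_type_right, ite_mul, zero_mul, Finset.sum_ite_eq, Finset.mem_univ, if_true]

theorem Chat_transpose_mulVec_castSucc (w : Fin d × Fin n → ℝ) (k : Fin d) (a : Fin n) :
    ((D.Chat d t)ᵀ *ᵥ w) (k.castSucc, a) =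
      ((D.C (d * t + k))ᵀ *ᵥ fun b => w (k, b)) a := by
  simp only [Chat, Matrix.mulVec, dotProduct, Matrix.of_apply, Matrix.transpose_apply,
    Fin.val_castSucc, Fin.val_inj,
    Fintype.sum_prod_type_right, ite_mul, zero_mul, Finset.sum_ite_eq', Finset.mem_univ, if_true]

theorem Chat_transpose_mulVec_last (w : Fin d × Fin n → ℝ) (a : Fin n) :
    ((D.Chat d t)ᵀ *ᵥ w) (Fin.last d, a) = 0 := by
  have (i : Fin d) : (i : ℕ) ≠ d := i.is_lt.ne
  simp [Chat, Matrix.mulVec, dotProduct, this]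

theorem Rhat_mulVec (u : Fin d × Fin m → ℝ) (k : Fin d) (a : Fin m) :
    (D.Rhat d t *ᵥ u) (k, a) = (D.R (d * t + k) *ᵥ fun b => u (k, b)) a := by
  simp only [Rhat, Matrix.mulVec, dotProduct, Matrix.of_apply,
    Fintype.sum_prod_type_right, ite_mul, zero_mul, Finset.sum_ite_eq, Finset.mem_univ, if_true]

theorem firstBlock_mulVec_zero (x : Fin n → ℝ) (a : Fin n) :
    (firstBlock n d *ᵥ x) (0, a) = x a := by
  simp [firstBlock, Matrix.mulVec, dotProduct]

theorem firstBlock_mulVec_succ (x : Fin n → ℝ) (k : Fin d) (a : Fin n) :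
    (firstBlock n d *ᵥ x) (k.succ, a) = 0 := by
  simp [firstBlock, Matrix.mulVec, dotProduct]

theorem lastBlock_mulVec (v : Fin (d + 1) × Fin n → ℝ) (a : Fin n) :
    (lastBlock n d *ᵥ v) a = v (Fin.last d, a) := by
  simp only [lastBlock, Matrix.mulVec, dotProduct, Matrix.of_apply, Fintype.sum_prod_type,
    ite_and, ite_mul, zero_mul, one_mul]
  rw [Finset.sum_eq_single (Fin.last d)] <;> simp +contextual

/-- Forward substitution: the matrix is block lower bidiagonal with identity diagonal blocks. -/
theorem isUnit_Ahat : IsUnit (D.Ahat d t) := by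
  rw [← Matrix.mulVec_injective_iff_isUnit]
  refine (injective_iff_map_eq_zero (D.Ahat d t).mulVecLin).2 fun v hv => ?_
  replace hv : D.Ahat d t *ᵥ v = 0 := hv
  have key (i : Fin (d + 1)) : ∀ a, v (i, a) = 0 := by
    induction i using Fin.induction with
    | zero => exact fun a => by rw [← D.Ahat_mulVec_zero d t v, hv]; rfl
    | succ k ih =>
      intro a
      have h := D.Ahat_mulVec_succ d t v k a
      have h0 : (fun b => v (k.castSucc, b)) = 0 := funext ih
      rw [hv, h0, Matrix.mulVec_zero] at h
      simpa using h.symm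
  exact funext fun p => key p.1 p.2

variable {D}

theorem Rhat_posDef (hR : ∀ k, (D.R k).PosDef) : (D.Rhat d t).PosDef := by
  refine Matrix.PosDef.of_dotProduct_mulVec_pos ?_ fun u hu => ?_
  · ext p q
    have h := (hR (d * t + p.1)).isHermitian.apply p.2 q.2
    rcases p with ⟨k, a⟩
    rcases q with ⟨j, b⟩
    by_cases hk : k = j
    · subst hk
      simpa [Rhat] using h
    · simp [Rhat, hk, Ne.symm hk]
  · have h1 : star u ⬝ᵥ D.Rhat d t *ᵥ u = ∑ k : Fin d,
        (fun b => u (k, b)) ⬝ᵥ D.R (d * t + k) *ᵥ fun b => u (k, b) := by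
      simp only [dotProduct, Fintype.sum_prod_type, Rhat_mulVec, star_trivial]
    have hnn (k : Fin d) :
        0 ≤ (fun b => u (k, b)) ⬝ᵥ D.R (d * t + k) *ᵥ fun b => u (k, b) :=
      (hR _).posSemidef.dotProduct_mulVec_nonneg _
    obtain ⟨p, hp⟩ := Function.ne_iff.1 hu
    rw [h1]
    refine Finset.sum_pos' (fun k _ => hnn k) ⟨p.1, Finset.mem_univ _, ?_⟩
    exact (hR _).dotProduct_mulVec_pos fun h0 => hp (congrFun h0 p.2)

theorem Rtilde_posDef (hR : ∀ k, (D.R k).PosDef) : (D.Rtilde d t).PosDef := by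
  have h := (Rhat_posDef d t hR).add_transpose_mul_mul Matrix.PosSemidef.one (D.Delta d t)
  rwa [Matrix.mul_one] at h

/-- By Woodbury, `Qtilde` is `Ξᵀ (1 + Δ Rhat⁻¹ Δᵀ)⁻¹ Ξ`, a congruence by the injective `Ξ`. -/
theorem Qtilde_posDef (hR : ∀ k, (D.R k).PosDef)
    (hobs : Function.Injective (D.Xi d t).mulVec) : (D.Qtilde d t).PosDef := by
  have hRhat := Rhat_posDef d t hR
  have h := hRhat.inv_inv_add_mul_mul Matrix.PosDef.one (D.Delta d t)
  rw [Matrix.mul_one, Matrix.one_mul, Matrix.mul_one] at h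
  have hp : (1⁻¹ + D.Delta d t * (D.Rhat d t)⁻¹ * (D.Delta d t)ᵀ).PosDef :=
    Matrix.PosDef.one.inv.add_posSemidef
      (hRhat.inv.posSemidef.mul_mul_conjTranspose_same (D.Delta d t))
  have hq : ((D.Xi d t)ᵀ * (1⁻¹ + D.Delta d t * (D.Rhat d t)⁻¹ * (D.Delta d t)ᵀ)⁻¹
      * D.Xi d t).PosDef := hp.inv.conjTranspose_mul_mul_same hobs
  rw [h] at hq
  simpa only [Qtilde, Rtilde, Matrix.mul_sub, Matrix.sub_mul, Matrix.mul_one, Matrix.mul_assoc]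
    using hq

/-- The kernel of `Atilde` is trivial: along the optimal trajectory, a vanishing terminal state and
costate propagate backwards through the Hamiltonian system. -/
theorem isUnit_Atilde (hR : ∀ k, (D.R k).PosDef) (hA : ∀ k, IsUnit (D.A k)) :
    IsUnit (D.Atilde d t) := by
  rw [← Matrix.mulVec_injective_iff_isUnit]
  refine (injective_iff_map_eq_zero (D.Atilde d t).mulVecLin).2 fun x hx => ?_
  replace hx : D.Atilde d t *ᵥ x = 0 := hx
  have hdet := (Matrix.isUnit_iff_isUnit_det _).1 (D.isUnit_Ahat d t)
  have hdetT : IsUnit ((D.Ahat d t)ᵀ).det := by simpa using hdet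
  have hRdet := (Matrix.isUnit_iff_isUnit_det _).1 (Rtilde_posDef d t hR).isUnit
  -- `u` is the optimal control from `x` with no terminal cost, `X` its stacked trajectory and `w`
  -- the stacked costate.
  obtain ⟨u, hu⟩ : ∃ u, u = -((D.Rtilde d t)⁻¹ * (D.Delta d t)ᵀ * D.Xi d t) *ᵥ x := ⟨_, rfl⟩
  obtain ⟨X, hX⟩ : ∃ X, X = (D.Ahat d t)⁻¹ *ᵥ (firstBlock n d *ᵥ x + D.Bhat d t *ᵥ u) :=
    ⟨_, rfl⟩
  obtain ⟨w, hw⟩ : ∃ w, w = ((D.Ahat d t)ᵀ)⁻¹ *ᵥ ((D.Chat d t)ᵀ *ᵥ (D.Chat d t *ᵥ X)) :=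
    ⟨_, rfl⟩
  have state : D.Ahat d t *ᵥ X = firstBlock n d *ᵥ x + D.Bhat d t *ᵥ u := by
    rw [hX, Matrix.mulVec_mulVec, Matrix.mul_nonsing_inv _ hdet, Matrix.one_mulVec]
  have costate : (D.Ahat d t)ᵀ *ᵥ w = (D.Chat d t)ᵀ *ᵥ (D.Chat d t *ᵥ X) := by
    rw [hw, Matrix.mulVec_mulVec, Matrix.mul_nonsing_inv _ hdetT, Matrix.one_mulVec]
  have output : D.Chat d t *ᵥ X = D.Xi d t *ᵥ x + D.Delta d t *ᵥ u := by
    rw [hX, Xi, Delta]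
    simp only [Matrix.mulVec_add, Matrix.mulVec_mulVec, Matrix.mul_assoc]
  have control : D.Rhat d t *ᵥ u = -((D.Bhat d t)ᵀ *ᵥ w) := by
    have h1 : D.Rtilde d t *ᵥ u = -((D.Delta d t)ᵀ *ᵥ (D.Xi d t *ᵥ x)) := by
      rw [hu, Matrix.neg_mulVec, Matrix.mulVec_neg, Matrix.mulVec_mulVec, Matrix.mul_assoc,
        Matrix.mul_nonsing_inv_cancel_left _ _ hRdet, Matrix.mulVec_mulVec]
    have h2 : (D.Bhat d t)ᵀ *ᵥ w = (D.Delta d t)ᵀ *ᵥ (D.Chat d t *ᵥ X) := by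
      rw [hw, Delta]
      simp only [Matrix.mulVec_mulVec, Matrix.transpose_mul, Matrix.transpose_nonsing_inv,
        Matrix.mul_assoc]
    rw [h2, output, Matrix.mulVec_add]
    rw [Rtilde, Matrix.add_mulVec, ← Matrix.mulVec_mulVec] at h1
    rw [neg_add, ← h1]
    abel
  have terminal (a : Fin n) : X (Fin.last d, a) = 0 := by
    have h1 : lastBlock n d *ᵥ X = D.Atilde d t *ᵥ x := by
      rw [hX, hu, Atilde, Phi, Gamma]
      simp only [Matrix.mulVec_add, Matrix.mulVec_mulVec, Matrix.add_mulVec, Matrix.neg_mulVec,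
        Matrix.mulVec_neg, Matrix.mul_assoc, sub_eq_add_neg]
    rw [← lastBlock_mulVec d X, h1, hx]
    rfl
  -- Backwards in time: a zero costate at `k + 1` kills `u k` as `R` is invertible, then the zero
  -- state at `k + 1` kills the state at `k` as `A` is invertible, and the costate equation closes
  -- the loop. The last costate vanishes because the last block column of `Chat` is zero.
  have key (i : Fin (d + 1)) : (∀ a, X (i, a) = 0) ∧ ∀ a, w (i, a) = 0 := by
    induction i using Fin.reverseInduction with
    | last =>
      refine ⟨terminal, fun a => ?_⟩
      rw [← D.Ahat_transpose_mulVec_last d t w, costate, Chat_transpose_mulVec_last]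
    | cast k ih =>
      have hw0 : (fun b => w (k.succ, b)) = 0 := funext ih.2
      have hu0 : (fun b => u (k, b)) = 0 := by
        have h1 : D.R (d * t + k) *ᵥ (fun b => u (k, b)) = 0 := by
          funext a
          rw [← Rhat_mulVec, control, Pi.neg_apply, Bhat_transpose_mulVec, hw0,
            Matrix.mulVec_zero]
          simp
        exact Matrix.mulVec_injective_iff_isUnit.2 (hR _).isUnit
          (h1.trans (Matrix.mulVec_zero _).symm)
      have hX0 : (fun b => X (k.castSucc, b)) = 0 := by
        have h1 : D.A (d * t + k) *ᵥ (fun b => X (k.castSucc, b)) = 0 := by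
          funext a
          have h := D.Ahat_mulVec_succ d t X k a
          rw [state, Pi.add_apply, firstBlock_mulVec_succ, Bhat_mulVec_succ, hu0,
            Matrix.mulVec_zero, ih.1 a] at h
          simpa using h.symm
        exact Matrix.mulVec_injective_iff_isUnit.2 (hA _) (h1.trans (Matrix.mulVec_zero _).symm)
      refine ⟨fun a => congrFun hX0 a, fun a => ?_⟩
      have h := D.Ahat_transpose_mulVec_castSucc d t w k a
      have hC : (fun b => (D.Chat d t *ᵥ X) (k, b)) = 0 := by
        funext b
        rw [Chat_mulVec, hX0, Matrix.mulVec_zero]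
      rw [costate, Chat_transpose_mulVec_castSucc, hC, hw0, Matrix.mulVec_zero,
        Matrix.mulVec_zero] at h
      simpa using h.symm
  funext a
  have h := D.Ahat_mulVec_zero d t X a
  rw [state, Pi.add_apply, firstBlock_mulVec_zero, Bhat_mulVec_zero, add_zero, (key 0).1 a] at h
  exact h

end LQData

/-! ### The contraction theorem -/

theorem theorem1 {n m : ℕ} (hn : 0 < n) (D : LQData n m)
    (hQ : ∀ k, (D.Q k).PosSemidef) (hR : ∀ k, (D.R k).PosDef) (hA : ∀ k, IsUnit (D.A k))
    (d : ℕ) (hd : 0 < d)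
    (hctr : ∀ t, (D.Gamma d t).rank = n) (hobs : ∀ t, (D.Xi d t).rank = n) (t : ℕ) :
    -- every matrix that is inverted is invertible, and `epsilon` is taken of a symmetric matrix
    (IsUnit (D.Ahat d t) ∧ IsUnit (D.Rtilde d t) ∧ IsUnit (D.Atilde d t) ∧
      IsUnit (D.zetaMat d t) ∧ IsUnit (D.epsilonInner d t) ∧ (D.epsilonMat d t).IsSymm) ∧
    -- the lifted Riccati operator is well defined and preserves positive definiteness
    (∀ P : Matrix (Fin n) (Fin n) ℝ, P.PosDef →
      IsUnit (D.Rtilde d t + (D.Btilde d t)ᵀ * P * D.Btilde d t) ∧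
        (D.liftedRiccati d t P).PosDef) ∧
    -- the rate is a strict contraction rate
    (0 < D.zeta d t + D.epsilon d t ∧ D.rho d t < 1) ∧
    -- the contraction estimate
    ∀ X Y : Matrix (Fin n) (Fin n) ℝ, X.PosDef → Y.PosDef →
      riemDist (D.liftedRiccati d t X) (D.liftedRiccati d t Y) ≤ D.rho d t * riemDist X Y := by
  have hRt := LQData.Rtilde_posDef d t hR
  have hAt := LQData.isUnit_Atilde d t hR hA
  have hXi : Function.Injective (D.Xi d t).mulVec :=
    Matrix.mulVec_injective_of_rank_eq (by simpa using hobs t)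
  -- Full row rank of `Γ` is full column rank of its transpose.
  have hGa : Function.Injective (D.Btilde d t).vecMul := by
    have h : Function.Injective ((D.Gamma d t)ᵀ).mulVec :=
      Matrix.mulVec_injective_of_rank_eq (by simpa [Matrix.rank_transpose] using hctr t)
    intro x y hxy
    refine h ?_
    simpa only [Matrix.mulVec_transpose, LQData.Btilde] using hxy
  have hQt := LQData.Qtilde_posDef d t hR hXi
  obtain ⟨E, hE⟩ : ∃ E, E = ((D.Atilde d t)⁻¹ * D.Btilde d t) * (D.Rtilde d t)⁻¹
      * ((D.Atilde d t)⁻¹ * D.Btilde d t)ᵀ := ⟨_, rfl⟩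
  have hEp : E.PosDef := by
    rw [hE]
    refine hRt.inv.mul_mul_transpose fun x y hxy => ?_
    simp only [← Matrix.vecMul_vecMul] at hxy
    exact Matrix.vecMul_injective_iff_isUnit.2 (Matrix.isUnit_nonsing_inv_iff.2 hAt) (hGa hxy)
  have hzeta : D.zetaMat d t = D.Qtilde d t + D.Qtilde d t * E * D.Qtilde d t := by
    rw [LQData.zetaMat, hE]
    simp only [Matrix.transpose_mul, Matrix.transpose_nonsing_inv, Matrix.mul_assoc]
  have hinner : D.epsilonInner d t = D.Rtilde d t + ((D.Atilde d t)⁻¹ * D.Btilde d t)ᵀ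
      * D.Qtilde d t * ((D.Atilde d t)⁻¹ * D.Btilde d t) := by
    rw [LQData.epsilonInner]
    simp only [Matrix.transpose_mul, Matrix.transpose_nonsing_inv, Matrix.mul_assoc]
  have heps : D.epsilonMat d t = (D.Qtilde d t + E⁻¹)⁻¹ := by
    have h := hRt.inv_add_inv_eq hQt ((D.Atilde d t)⁻¹ * D.Btilde d t) (hE ▸ hEp)
    rw [hE, h, LQData.epsilonMat, hinner]
    simp only [Matrix.transpose_mul, Matrix.transpose_nonsing_inv, Matrix.mul_assoc]
  have hzp : (D.zetaMat d t).PosDef := by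
    have hs : (D.Qtilde d t)ᵀ = D.Qtilde d t := hQt.isHermitian
    have := hQt.add_transpose_mul_mul hEp.posSemidef (D.Qtilde d t)
    rwa [hs, ← hzeta] at this
  have hep : (D.epsilonMat d t).PosDef := by
    rw [heps]
    exact (hQt.add hEp.inv).inv
  have hz0 : 0 < D.zeta d t := norm2_pos hn hzp.inv
  have he0 : 0 < D.epsilon d t := lambdaMin_pos hn hep
  refine ⟨⟨D.isUnit_Ahat d t, hRt.isUnit, hAt, hzp.isUnit, ?_, hep.isHermitian⟩,
    fun P hP => ⟨(hRt.add_transpose_mul_mul hP.posSemidef _).isUnit,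
      Matrix.PosDef.riccati_posDef hAt hRt hQt hP⟩,
    ⟨by positivity, ?_⟩, fun X Y hX hY => ?_⟩
  · rw [hinner]
    exact (hRt.add_transpose_mul_mul hQt.posSemidef _).isUnit
  · rw [LQData.rho, div_lt_one (by positivity)]
    linarith
  · have h := riemDist_riccati_le hn hAt hRt hQt hEp hE hX hY
    rwa [← hzeta, ← heps] at h
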